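/- For every error bound $\varepsilon < 1/2$ there are constants $c > 0$ and $N_0$ such that the following holds for all $N \ge N_0$. For a binary matrix $A \in \{0,1\}^{N\times N}$ (not necessarily symmetric), let $\lambda_1(A),\dots,\lambda_N(A)$ be its complex eigenvalues, repeated according to algebraic multiplicity and sorted in descending order of their real parts, where eigenvalues with equal real parts are sorted in descending order of their imaginary parts. Consider a quantum algorithm that receives an integer $k$ with $1 \le k \le N-1$ and has access to $A$ through the unitary oracle $$O_A : |i\rangle|j\rangle|b\rangle \mapsto |i\rangle|j\rangle|b \oplus A_{i,j}\rangle ,\qquad i,j \in \{1,\dots,N\},\ b\in\{0,1\}$$ (in particular $|i\rangle|j\rangle|0\rangle \mapsto |i\rangle|j\rangle|A_{i,j}\rangle$). That is, for each $k$ the algorithm applies, to a fixed initial basis state of the three query registers and a finite-dimensional workspace, unitaries that do not depend on $A$, interleaved with a number $T_k$ of applications of $O_A$, and then answers TRUE or FALSE according to a measurement in the computational basis. Suppose that for every $A \in \{0,1\}^{N\times N}$ and every $k \in \{1,\dots,N-1\}$ the algorithm answers, with probability at least $1-\varepsilon$, TRUE if $\mathrm{gap}_k := |\lambda_k(A)-\lambda_{k+1}(A)|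 > 0$ and FALSE otherwise. Then $\max_{1\le k\le N-1} T_k \ge c N^2$; that is, the algorithm must make $\Omega(N^2)$ queries to $O_A$. -/

import Mathlib

/-! Eigenvalues of a binary matrix, sorted and with multiplicity. -/

namespace SpectralGapQuery

/-- A binary `N × N` matrix; no symmetry is required. -/
abbrev BinaryMatrix (N : ℕ) : Type := Matrix (Fin N) (Fin N) Bool

/-- The binary matrix as a complex matrix with entries `0` and `1`. -/
def toComplex {N : ℕ} (A : BinaryMatrix N) : Matrix (Fin N) (Fin N) ℂ :=
  A.map fun b => if b then 1 else 0

/-- `z` is listed before `w`: larger real part first, and for equal real parts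
larger imaginary part first. -/
def Precedes (z w : ℂ) : Prop :=
  w.re < z.re ∨ (w.re = z.re ∧ w.im ≤ z.im)

instance : IsTrans ℂ Precedes where
  trans a b c hab hbc := by
    unfold Precedes at *
    rcases hab with h | ⟨h, h'⟩ <;> rcases hbc with g | ⟨g, g'⟩
    · exact Or.inl (g.trans h)
    · exact Or.inl (g ▸ h)
    · exact Or.inl (h ▸ g)
    · exact Or.inr ⟨g.trans h, g'.trans h'⟩

instance : Std.Antisymm Precedes where
  antisymm a b hab hba := by
    unfold Precedes at *
    rcases hab with h | ⟨h, h'⟩ <;> rcases hba with g | ⟨g, g'⟩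
    · exact absurd h (not_lt.mpr g.le)
    · exact absurd g h.ne'
    · exact absurd h g.ne'
    · exact Complex.ext g (le_antisymm g' h')

instance : Std.Total Precedes where
  total a b := by
    unfold Precedes
    rcases lt_trichotomy a.re b.re with h | h | h
    · exact Or.inr (Or.inl h)
    · rcases le_total a.im b.im with g | g
      · exact Or.inr (Or.inr ⟨h, g⟩)
      · exact Or.inl (Or.inr ⟨h.symm, g⟩)
    · exact Or.inl (Or.inl h)

open Classical in
/-- The complex eigenvalues of `A`, repeated according to algebraic multiplicity, sorted in
descending order. -/
noncomputable def eigenvalueList {N : ℕ} (A : BinaryMatrix N) : List ℂ :=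
  (toComplex A).charpoly.roots.sort Precedes

theorem length_eigenvalueList {N : ℕ} (A : BinaryMatrix N) :
    (eigenvalueList A).length = N := by
  rw [eigenvalueList, Multiset.length_sort, IsAlgClosed.card_roots_eq_natDegree,
    Matrix.charpoly_natDegree_eq_dim, Fintype.card_fin]

/-- `λ_k(A)`, counted from `k = 1` to `k = N` (the default value `0` is never used in that range).
-/
noncomputable def eigenvalue {N : ℕ} (A : BinaryMatrix N) (k : ℕ) : ℂ :=
  (eigenvalueList A).getD (k - 1) 0

/-- `gap_k = |λ_k(A) - λ_{k+1}(A)|`, for `1 ≤ k ≤ N - 1`. -/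
noncomputable def spectralGap {N : ℕ} (A : BinaryMatrix N) (k : ℕ) : ℝ :=
  ‖eigenvalue A k - eigenvalue A (k + 1)‖

/-! Quantum query algorithms with access to the entries of a binary matrix. -/

/-- Labels `(i, j, b, w)` of the computational basis states `|i⟩|j⟩|b⟩|w⟩`: row register,
column register, answer qubit, and a workspace of dimension `m`. -/
abbrev BasisLabel (N m : ℕ) : Type := Fin N × Fin N × Bool × Fin m

/-- The permutation `(i, j, b, w) ↦ (i, j, b ⊕ A i j, w)` of the basis labels. -/
def oracleMap {N : ℕ} (A : BinaryMatrix N) (m : ℕ) (x : BasisLabel N m) : BasisLabel N m :=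
  (x.1, x.2.1, xor x.2.2.1 (A x.1 x.2.1), x.2.2.2)

theorem oracleMap_oracleMap {N : ℕ} (A : BinaryMatrix N) (m : ℕ) (x : BasisLabel N m) :
    oracleMap A m (oracleMap A m x) = x := by
  simp [oracleMap]

/-- The oracle `O_A : |i⟩|j⟩|b⟩|w⟩ ↦ |i⟩|j⟩|b ⊕ A i j⟩|w⟩`, as a matrix. -/
def oracle {N : ℕ} (A : BinaryMatrix N) (m : ℕ) :
    Matrix (BasisLabel N m) (BasisLabel N m) ℂ :=
  Matrix.of fun y x => if y = oracleMap A m x then 1 else 0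

theorem oracle_basis_false {N : ℕ} (A : BinaryMatrix N) (m : ℕ) (i j : Fin N) (w : Fin m) :
    (oracle A m).mulVec (Pi.single (i, j, false, w) 1) = Pi.single (i, j, A i j, w) 1 := by
  ext y
  simp [oracle, oracleMap, Pi.single_apply]

theorem oracle_mulVec_apply {N : ℕ} (A : BinaryMatrix N) (m : ℕ) (ψ : BasisLabel N m → ℂ)
    (y : BasisLabel N m) : (oracle A m).mulVec ψ y = ψ (oracleMap A m y) := by
  have h : ∀ x, (y = oracleMap A m x) ↔ (oracleMap A m y = x) := fun x =>
    ⟨fun h => by rw [h, oracleMap_oracleMap], fun h => by rw [← h, oracleMap_oracleMap]⟩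
  simp [oracle, Matrix.mulVec, dotProduct, h]

theorem oracle_mem_unitaryGroup {N : ℕ} (A : BinaryMatrix N) (m : ℕ) :
    oracle A m ∈ Matrix.unitaryGroup (BasisLabel N m) ℂ := by
  have hinv : oracle A m * oracle A m = 1 := by
    apply Matrix.mulVec_injective
    funext ψ
    rw [← Matrix.mulVec_mulVec, Matrix.one_mulVec]
    funext y
    rw [oracle_mulVec_apply, oracle_mulVec_apply, oracleMap_oracleMap]
  have hstar : star (oracle A m) = oracle A m := by
    ext y x
    have h : (x = oracleMap A m y) ↔ (y = oracleMap A m x) :=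
      ⟨fun h => by rw [h, oracleMap_oracleMap], fun h => by rw [h, oracleMap_oracleMap]⟩
    simp [oracle, Matrix.star_apply, h, apply_ite]
  rw [Matrix.mem_unitaryGroup_iff, hstar, hinv]

/-- A quantum query algorithm for binary `N × N` matrices: it starts in a computational basis
state, applies `U 0, O_A, U 1, O_A, …, O_A, U numQueries` for unitaries `U t` that do not depend
on `A`, measures in the computational basis, and answers TRUE if the outcome lies in `accept`.
The values `U t` with `t > numQueries` are not used. -/
structure QueryAlgorithm (N : ℕ) where
  /-- the dimension of the workspace -/
  workDim : ℕ
  /-- the number of oracle queries -/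
  numQueries : ℕ
  /-- the label of the initial basis state -/
  init : BasisLabel N workDim
  /-- the unitaries applied between the queries -/
  U : ℕ → Matrix.unitaryGroup (BasisLabel N workDim) ℂ
  /-- the measurement outcomes on which the answer is TRUE -/
  accept : Finset (BasisLabel N workDim)

namespace QueryAlgorithm

/-- The state after `t` queries and the unitary `U t`. -/
def state {N : ℕ} (Q : QueryAlgorithm N) (A : BinaryMatrix N) :
    ℕ → BasisLabel N Q.workDim → ℂ
  | 0 => (Q.U 0).1.mulVec (Pi.single Q.init 1)
  | t + 1 => (Q.U (t + 1)).1.mulVec ((oracle A Q.workDim).mulVec (Q.state A t))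

/-- The probability that the algorithm answers TRUE on the matrix `A`. -/
noncomputable def acceptProb {N : ℕ} (Q : QueryAlgorithm N) (A : BinaryMatrix N) : ℝ :=
  ∑ x ∈ Q.accept, ‖Q.state A Q.numQueries x‖ ^ 2

/-- On every matrix, the algorithm gives the right answer to the question `P A` with probability
at least `1 - ε`. -/
def Decides {N : ℕ} (Q : QueryAlgorithm N) (ε : ℝ) (P : BinaryMatrix N → Prop) : Prop :=
  ∀ A : BinaryMatrix N,
    (P A → 1 - ε ≤ Q.acceptProb A) ∧ (¬ P A → 1 - ε ≤ 1 - Q.acceptProb A)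

end QueryAlgorithm

end SpectralGapQuery

namespace SpectralGapQuery

/-! ### Inner products of states under queries, and the adversary bound. -/

open Matrix Finset
open Polynomial (X C)

/-! The case `k = 1` already forces the bound, by a reduction from exact counting. Encode a set `s`
of positions in an `n × n` grid as a 0/1 matrix `B`. With the all-ones matrix `J`, the block matrix
with off-diagonal blocks `B` and `J` has nonzero eigenvalues `±√|s|`, because `BJ` has rank one and
trace `|s|`. A further diagonal block contributes the eigenvalue `r`. If `|s| ≥ r²`, the top two
eigenvalues are `√|s|` and `r`, so the first gap vanishes exactly when `|s| = r²`
(`spectralGap_gadget`).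

The algorithm thus separates the sets of size `r²` from those of size `r² + 1` inside a grid of
`4r²` cells. Adding one element to `s` changes one matrix entry, and a query lowers the real inner
product of the two corresponding states by at most the weight they place on that entry. Summing over
all pairs `s ⊂ s ∪ {a}` between the two layers gives `Ω(r²)` queries (`layer_lower_bound`), and `r`
is of order `N`. -/

theorem sum_oracleMap_filter {N : ℕ} (A : BinaryMatrix N) (m : ℕ) (P : Fin N × Fin N → Prop)
    [DecidablePred P] (h : BasisLabel N m → ℝ) :
    ∑ y with P (y.1, y.2.1), h (oracleMap A m y) = ∑ y with P (y.1, y.2.1), h y :=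
  Finset.sum_nbij' (oracleMap A m) (oracleMap A m) (by simp [oracleMap]) (by simp [oracleMap])
    (fun y _ => oracleMap_oracleMap A m y) (fun y _ => oracleMap_oracleMap A m y) (fun _ _ => rfl)

/-- The squared norm of the part of `ψ` that queries the position `p`. -/
noncomputable def queryWeight {N m : ℕ} (ψ : BasisLabel N m → ℂ) (p : Fin N × Fin N) : ℝ :=
  ∑ y with (y.1, y.2.1) = p, ‖ψ y‖ ^ 2

theorem sum_queryWeight {N m : ℕ} (ψ : BasisLabel N m → ℂ) :
    ∑ p, queryWeight ψ p = ∑ y, ‖ψ y‖ ^ 2 := by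
  simpa [queryWeight] using Finset.sum_fiberwise (Finset.univ : Finset (BasisLabel N m))
    (fun y => (y.1, y.2.1)) (fun y => ‖ψ y‖ ^ 2)

theorem queryWeight_nonneg {N m : ℕ} (ψ : BasisLabel N m → ℂ) (p : Fin N × Fin N) :
    0 ≤ queryWeight ψ p :=
  Finset.sum_nonneg fun _ _ => by positivity

theorem abs_re_star_mul_le (z w : ℂ) : |(star z * w).re| ≤ (‖z‖ ^ 2 + ‖w‖ ^ 2) / 2 := by
  have h1 : |(star z * w).re| ≤ ‖z‖ * ‖w‖ := by
    simpa using Complex.abs_re_le_norm (star z * w)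
  nlinarith [sq_nonneg (‖z‖ - ‖w‖)]

/-- One query changes the inner product of two states little when the two matrices differ
in a single position. -/
theorem inner_sub_inner_oracle_le {N m : ℕ} (A B : BinaryMatrix N) (p : Fin N × Fin N)
    (hAB : ∀ q, q ≠ p → A q.1 q.2 = B q.1 q.2) (ψ φ : BasisLabel N m → ℂ) :
    (star ψ ⬝ᵥ φ).re - (star (oracle A m *ᵥ ψ) ⬝ᵥ (oracle B m *ᵥ φ)).re ≤
      queryWeight ψ p + queryWeight φ p := by
  simp only [dotProduct, Pi.star_apply, oracle_mulVec_apply, Complex.re_sum]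
  rw [← Finset.sum_filter_add_sum_filter_not univ
      (fun y : BasisLabel N m => (y.1, y.2.1) = p) (fun y => (star (ψ y) * φ y).re),
    ← Finset.sum_filter_add_sum_filter_not univ (fun y : BasisLabel N m => (y.1, y.2.1) = p)
      (fun y => (star (ψ (oracleMap A m y)) * φ (oracleMap B m y)).re)]
  -- Away from `p` both oracles act as the same permutation, so only labels at `p` can change the
  -- inner product.
  have hoff : ∑ y : BasisLabel N m with ¬ (y.1, y.2.1) = p,
      (star (ψ (oracleMap A m y)) * φ (oracleMap B m y)).re =
      ∑ y : BasisLabel N m with ¬ (y.1, y.2.1) = p, (star (ψ y) * φ y).re := by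
    rw [← sum_oracleMap_filter A m (fun q => ¬ q = p) (fun y => (star (ψ y) * φ y).re)]
    refine Finset.sum_congr rfl fun y hy => ?_
    have : oracleMap B m y = oracleMap A m y := by
      simp only [oracleMap]
      rw [hAB (y.1, y.2.1) (by simpa using hy)]
    rw [this]
  have hon : ∑ y : BasisLabel N m with (y.1, y.2.1) = p, (star (ψ y) * φ y).re ≤
      (queryWeight ψ p + queryWeight φ p) / 2 := by
    rw [queryWeight, queryWeight, ← Finset.sum_add_distrib, Finset.sum_div]
    exact Finset.sum_le_sum fun y _ => (le_abs_self _).trans (abs_re_star_mul_le _ _)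
  have hon' : -((queryWeight ψ p + queryWeight φ p) / 2) ≤ ∑ y : BasisLabel N m with
      (y.1, y.2.1) = p, (star (ψ (oracleMap A m y)) * φ (oracleMap B m y)).re := by
    rw [queryWeight, queryWeight,
      ← sum_oracleMap_filter A m (fun q => q = p) (fun y => ‖ψ y‖ ^ 2),
      ← sum_oracleMap_filter B m (fun q => q = p) (fun y => ‖φ y‖ ^ 2),
      ← Finset.sum_add_distrib, Finset.sum_div, ← Finset.sum_neg_distrib]
    exact Finset.sum_le_sum fun y _ => neg_le_of_abs_le (abs_re_star_mul_le _ _)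
  linarith

theorem inner_unitary_mulVec {n : Type*} [Fintype n] [DecidableEq n]
    (U : Matrix.unitaryGroup n ℂ) (ψ φ : n → ℂ) :
    star (U.1 *ᵥ ψ) ⬝ᵥ (U.1 *ᵥ φ) = star ψ ⬝ᵥ φ := by
  rw [star_mulVec, dotProduct_mulVec, vecMul_vecMul, ← star_eq_conjTranspose,
    Matrix.mem_unitaryGroup_iff'.mp U.2, vecMul_one]

namespace QueryAlgorithm

variable {N : ℕ} (Q : QueryAlgorithm N)

theorem inner_state_zero (A B : BinaryMatrix N) : star (Q.state A 0) ⬝ᵥ Q.state B 0 = 1 := by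
  rw [state, state, inner_unitary_mulVec]
  simp

theorem inner_state_self (A : BinaryMatrix N) (t : ℕ) :
    star (Q.state A t) ⬝ᵥ Q.state A t = 1 := by
  induction t with
  | zero => exact Q.inner_state_zero A A
  | succ t ih =>
    rw [state, inner_unitary_mulVec]
    exact (inner_unitary_mulVec ⟨_, oracle_mem_unitaryGroup A Q.workDim⟩ _ _).trans ih

theorem sum_norm_sq_state (A : BinaryMatrix N) (t : ℕ) : ∑ y, ‖Q.state A t y‖ ^ 2 = 1 := by
  have h := congrArg Complex.re (Q.inner_state_self A t)
  simp only [dotProduct, Pi.star_apply, Complex.re_sum, Complex.one_re] at h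
  rw [← h]
  refine Finset.sum_congr rfl fun y _ => ?_
  rw [Complex.sq_norm, Complex.normSq_apply]
  simp

theorem inner_state_sub_succ_le (A B : BinaryMatrix N) (p : Fin N × Fin N)
    (hAB : ∀ q, q ≠ p → A q.1 q.2 = B q.1 q.2) (t : ℕ) :
    (star (Q.state A t) ⬝ᵥ Q.state B t).re - (star (Q.state A (t + 1)) ⬝ᵥ Q.state B (t + 1)).re ≤
      queryWeight (Q.state A t) p + queryWeight (Q.state B t) p := by
  rw [state, state, inner_unitary_mulVec]
  exact inner_sub_inner_oracle_le A B p hAB _ _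

/-- States that are told apart by a measurement have a small inner product. -/
theorem inner_state_le (A B : BinaryMatrix N) :
    (star (Q.state A Q.numQueries) ⬝ᵥ Q.state B Q.numQueries).re ≤
      1 - (Q.acceptProb B - Q.acceptProb A) ^ 2 / 2 := by
  classical
  set ψ := Q.state A Q.numQueries with hψ
  set φ := Q.state B Q.numQueries with hφ
  have hp : ∑ y ∈ Q.acceptᶜ, ‖ψ y‖ ^ 2 = 1 - Q.acceptProb A := by
    rw [← Q.sum_norm_sq_state A Q.numQueries, ← Finset.sum_add_sum_compl Q.accept, acceptProb]
    ring
  have hq : ∑ y ∈ Q.acceptᶜ, ‖φ y‖ ^ 2 = 1 - Q.acceptProb B := by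
    rw [← Q.sum_norm_sq_state B Q.numQueries, ← Finset.sum_add_sum_compl Q.accept, acceptProb]
    ring
  have hp0 : 0 ≤ Q.acceptProb A := Finset.sum_nonneg fun _ _ => by positivity
  have hq0 : 0 ≤ Q.acceptProb B := Finset.sum_nonneg fun _ _ => by positivity
  have hp1 : 0 ≤ 1 - Q.acceptProb A := hp ▸ Finset.sum_nonneg fun _ _ => by positivity
  have hq1 : 0 ≤ 1 - Q.acceptProb B := hq ▸ Finset.sum_nonneg fun _ _ => by positivity
  have hu := Finset.sum_mul_sq_le_sq_mul_sq Q.accept (fun y => ‖ψ y‖) (fun y => ‖φ y‖)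
  have hv := Finset.sum_mul_sq_le_sq_mul_sq Q.acceptᶜ (fun y => ‖ψ y‖) (fun y => ‖φ y‖)
  rw [hp, hq] at hv
  change _ ≤ Q.acceptProb A * Q.acceptProb B at hu
  have huv : (star ψ ⬝ᵥ φ).re ≤
      ∑ y ∈ Q.accept, ‖ψ y‖ * ‖φ y‖ + ∑ y ∈ Q.acceptᶜ, ‖ψ y‖ * ‖φ y‖ := by
    rw [Finset.sum_add_sum_compl, dotProduct, Complex.re_sum]
    refine Finset.sum_le_sum fun y _ => ?_
    simpa using Complex.re_le_norm (star (ψ y) * φ y)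
  refine huv.trans ?_
  have hu0 : 0 ≤ ∑ y ∈ Q.accept, ‖ψ y‖ * ‖φ y‖ := Finset.sum_nonneg fun _ _ => by positivity
  have hv0 : 0 ≤ ∑ y ∈ Q.acceptᶜ, ‖ψ y‖ * ‖φ y‖ := Finset.sum_nonneg fun _ _ => by positivity
  generalize ∑ y ∈ Q.accept, ‖ψ y‖ * ‖φ y‖ = u at *
  generalize ∑ y ∈ Q.acceptᶜ, ‖ψ y‖ * ‖φ y‖ = v at *
  generalize Q.acceptProb A = p at *
  generalize Q.acceptProb B = q at *
  -- Cauchy–Schwarz gives `u² ≤ pq` and `v² ≤ (1-p)(1-q)`; AM-GM then bounds the cross term, so that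
  -- `(u+v)² ≤ 1 - (q-p)² ≤ (1 - (q-p)²/2)²`.
  have h1 : 2 * (u * v) ≤ p * (1 - p) + q * (1 - q) := by
    refine abs_le_of_sq_le_sq' (a := 2 * (u * v)) ?_ (by positivity) |>.2
    have := mul_le_mul hu hv (sq_nonneg v) (by positivity)
    nlinarith [sq_nonneg (p * (1 - p) - q * (1 - q))]
  refine abs_le_of_sq_le_sq' (a := u + v) ?_ (by nlinarith) |>.2
  nlinarith [sq_nonneg ((q - p) ^ 2)]

/-- The adversary bound for telling apart two consecutive layers of a cube that is embedded
in the binary matrices. -/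
theorem layer_lower_bound {ι : Type*} [Fintype ι] [DecidableEq ι]
    (A : Finset ι → BinaryMatrix N) (pos : ι → Fin N × Fin N) (hpos : Function.Injective pos)
    (hA : ∀ s a q, q ≠ pos a → A s q.1 q.2 = A (insert a s) q.1 q.2)
    (m : ℕ) (hm : m ≤ Fintype.card ι) (ε : ℝ) (hε : ε < 1 / 2)
    (hrej : ∀ s, s.card = m → Q.acceptProb (A s) ≤ ε)
    (hacc : ∀ s, s.card = m + 1 → 1 - ε ≤ Q.acceptProb (A s)) :
    ((Fintype.card ι : ℝ) - m) * (m + 1) * ((1 - 2 * ε) ^ 2 / 2) ≤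
      Q.numQueries * (Fintype.card ι + 1) := by
  set M := Fintype.card ι with hM
  -- The progress measure: one inner product per edge of the cube between layers `m` and `m + 1`.
  let W : ℕ → ℝ := fun t => ∑ s ∈ powersetCard m (univ : Finset ι), ∑ a ∈ sᶜ,
    (star (Q.state (A s) t) ⬝ᵥ Q.state (A (insert a s)) t).re
  have hcard : ∀ c : ℝ, ∑ s ∈ powersetCard m (univ : Finset ι), ∑ _a ∈ sᶜ, c =
      M.choose m * ((M - m) * c) := by
    intro c
    rw [Finset.sum_congr rfl (g := fun _ => (M - m) * c), Finset.sum_const, card_powersetCard,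
      nsmul_eq_mul, card_univ]
    intro s hs
    rw [Finset.sum_const, card_compl, (mem_powersetCard.mp hs).2, nsmul_eq_mul, Nat.cast_sub hm]
  -- The same edges, indexed by their upper endpoint.
  have hswap : ∀ f : Finset ι → ι → ℝ,
      ∑ s ∈ powersetCard m (univ : Finset ι), ∑ a ∈ sᶜ, f (insert a s) a =
        ∑ s ∈ powersetCard (m + 1) (univ : Finset ι), ∑ a ∈ s, f s a := by
    intro f
    rw [Finset.sum_sigma', Finset.sum_sigma']
    refine Finset.sum_nbij' (fun x => ⟨insert x.2 x.1, x.2⟩) (fun x => ⟨x.1.erase x.2, x.2⟩)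
      ?_ ?_ ?_ ?_ ?_
    · rintro ⟨s, a⟩ h
      simp only [mem_sigma, mem_powersetCard, subset_univ, true_and, mem_compl] at h ⊢
      simp [card_insert_of_notMem h.2, h.1]
    · rintro ⟨s, a⟩ h
      simp only [mem_sigma, mem_powersetCard, subset_univ, true_and, mem_compl] at h ⊢
      simp [card_erase_of_mem h.2, h.1]
    · rintro ⟨s, a⟩ h
      simp only [mem_sigma, mem_compl] at h
      simp [erase_insert h.2]
    · rintro ⟨s, a⟩ h
      simp only [mem_sigma] at h
      simp [insert_erase h.2]
    · rintro ⟨s, a⟩ _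
      rfl
  -- Edges at one vertex belong to distinct positions, so their weights add up to at most the
  -- squared norm of one state.
  have hweight : ∀ (t : ℕ) (B : BinaryMatrix N) (u : Finset ι),
      ∑ a ∈ u, queryWeight (Q.state B t) (pos a) ≤ 1 := by
    intro t B u
    rw [← Q.sum_norm_sq_state B t, ← sum_queryWeight,
      ← Finset.sum_image (f := queryWeight (Q.state B t)) hpos.injOn]
    exact Finset.sum_le_sum_of_subset_of_nonneg (subset_univ _)
      fun p _ _ => queryWeight_nonneg _ p
  have hstep : ∀ t, W t - W (t + 1) ≤ M.choose m + M.choose (m + 1) := by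
    intro t
    calc W t - W (t + 1)
        ≤ ∑ s ∈ powersetCard m (univ : Finset ι), ∑ a ∈ sᶜ,
            (queryWeight (Q.state (A s) t) (pos a) +
              queryWeight (Q.state (A (insert a s)) t) (pos a)) := by
          simp only [W, ← Finset.sum_sub_distrib]
          exact Finset.sum_le_sum fun s _ => Finset.sum_le_sum fun a _ =>
            Q.inner_state_sub_succ_le _ _ _ (hA s a) t
      _ = ∑ s ∈ powersetCard m (univ : Finset ι), ∑ a ∈ sᶜ,
            queryWeight (Q.state (A s) t) (pos a) +
          ∑ s ∈ powersetCard (m + 1) (univ : Finset ι), ∑ a ∈ s,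
            queryWeight (Q.state (A s) t) (pos a) := by
          rw [← hswap fun s a => queryWeight (Q.state (A s) t) (pos a)]
          simp only [Finset.sum_add_distrib]
      _ ≤ ∑ _s ∈ powersetCard m (univ : Finset ι), (1 : ℝ) +
          ∑ _s ∈ powersetCard (m + 1) (univ : Finset ι), (1 : ℝ) :=
          add_le_add (Finset.sum_le_sum fun s _ => hweight _ _ _)
            (Finset.sum_le_sum fun s _ => hweight _ _ _)
      _ = _ := by simp [hM]
  have hall : ∀ t, W 0 - W t ≤ t * (M.choose m + M.choose (m + 1)) := by
    intro t
    induction t with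
    | zero => simp
    | succ t ih =>
      have := hstep t
      push_cast
      linarith
  have h0 : W 0 = M.choose m * ((M - m) * 1) := by
    rw [← hcard]
    simp only [W, inner_state_zero, Complex.one_re]
  have hT : W Q.numQueries ≤ M.choose m * ((M - m) * (1 - (1 - 2 * ε) ^ 2 / 2)) := by
    rw [← hcard]
    refine Finset.sum_le_sum fun s hs => Finset.sum_le_sum fun a ha => ?_
    refine (Q.inner_state_le _ _).trans ?_
    have hs' := (mem_powersetCard.mp hs).2
    have h1 := hrej s hs'
    have h2 := hacc (insert a s) (by rw [card_insert_of_notMem (mem_compl.mp ha), hs'])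
    nlinarith
  have hfin := hall Q.numQueries
  -- Counting edges from both layers eliminates the size of the upper one.
  have hK : (M.choose (m + 1) : ℝ) * (m + 1) = M.choose m * (M - m) := by
    rw [← Nat.cast_sub hm]
    exact_mod_cast Nat.choose_succ_right_eq M m
  have hK0 : (0 : ℝ) < M.choose m := by exact_mod_cast Nat.choose_pos hm
  refine le_of_mul_le_mul_left ?_ hK0
  have h3 : M.choose m * ((M - m) * ((1 - 2 * ε) ^ 2 / 2)) ≤
      Q.numQueries * ((M.choose m : ℝ) + M.choose (m + 1)) := by linarith
  have h4 := mul_le_mul_of_nonneg_right h3 (by positivity : (0 : ℝ) ≤ m + 1)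
  have h5 : (Q.numQueries * ((M.choose m : ℝ) + M.choose (m + 1))) * (m + 1) =
      M.choose m * (Q.numQueries * (M + 1)) := by
    linear_combination (Q.numQueries : ℝ) * hK
  linarith

end QueryAlgorithm

/-! ### Spectrum of the gadget matrix. -/

/-- Multiplying the characteristic matrix by the block matrix with rows `(X, 0)` and `(D, 1)` makes
it block triangular, with diagonal blocks `X² - BD` and `X`. Taking determinants puts a factor `X ^
n` on both sides, which cancels over a domain. -/
theorem charpoly_fromBlocks_antidiagonal {n R : Type*} [Fintype n] [DecidableEq n] [CommRing R]
    [IsDomain R] (B D : Matrix n n R) :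
    (fromBlocks 0 B D 0).charpoly = Polynomial.expand R 2 (B * D).charpoly := by
  have hX : (Polynomial.X : Polynomial R) ^ Fintype.card n ≠ 0 := pow_ne_zero _ Polynomial.X_ne_zero
  refine mul_right_cancel₀ hX ?_
  have h1 : (fromBlocks (0 : Matrix n n R) B D 0).charmatrix =
      fromBlocks (scalar n X) (-(B.map C)) (-(D.map C)) (scalar n X) := by
    rw [charmatrix_fromBlocks]
    simp [charmatrix]
  have h2 : (B * D).charmatrix.map (Polynomial.expand R 2) =
      scalar n X * scalar n X - B.map C * D.map C := by
    rw [← Matrix.map_mul]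
    ext1 i j
    rw [map_apply, charmatrix_apply, Matrix.sub_apply, map_sub, ← map_mul, scalar_apply, map_apply,
      Polynomial.expand_C, diagonal_apply, diagonal_apply]
    split_ifs <;> simp [sq]
  have h3 : Polynomial.expand R 2 (B * D).charpoly =
      (scalar n (X : Polynomial R) * scalar n X - B.map C * D.map C).det := by
    rw [charpoly, AlgHom.map_det, ← h2]
    rfl
  have h4 : (scalar n (X : Polynomial R)).det = X ^ Fintype.card n := by simp
  have h5 : fromBlocks (scalar n (X : Polynomial R)) (-(B.map C)) (-(D.map C)) (scalar n X) *
      fromBlocks (scalar n X) 0 (D.map C) 1 =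
      fromBlocks (scalar n X * scalar n X - B.map C * D.map C) (-(B.map C)) 0 (scalar n X) := by
    rw [fromBlocks_multiply]
    congr 1
    · simp [sub_eq_add_neg]
    · simp
    · rw [(scalar_commute X (Commute.all X) (D.map C)).eq]
      simp
    · simp
  have h6 := congrArg det h5
  rw [det_mul, det_fromBlocks_zero₂₁, det_fromBlocks_zero₁₂, det_one, mul_one, h4, ← h3, ← h1] at h6
  exact h6

/-- The block matrix whose spectrum is `±√|s|`, the number `r`, and zeros. -/
def blockGadget (n p r : ℕ) (s : Finset (Fin n × Fin n)) :
    Matrix ((Fin n ⊕ Fin n) ⊕ Fin p) ((Fin n ⊕ Fin n) ⊕ Fin p) Bool :=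
  fromBlocks
    (fromBlocks (of fun _ _ => false) (of fun i j => decide ((i, j) ∈ s))
      (of fun _ _ => true) (of fun _ _ => false))
    (of fun _ _ => false) (of fun _ _ => false) (of fun _ j => decide (j.val < r))

/-- `blockGadget` with its rows and columns numbered by `e`. -/
def gadget {N n p : ℕ} (e : (Fin n ⊕ Fin n) ⊕ Fin p ≃ Fin N) (r : ℕ)
    (s : Finset (Fin n × Fin n)) : BinaryMatrix N :=
  reindex e e (blockGadget n p r s)

theorem gadget_insert {N n p : ℕ} (e : (Fin n ⊕ Fin n) ⊕ Fin p ≃ Fin N) (r : ℕ)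
    (s : Finset (Fin n × Fin n)) (a : Fin n × Fin n) (q : Fin N × Fin N)
    (hq : q ≠ (e (.inl (.inl a.1)), e (.inl (.inr a.2)))) :
    gadget e r s q.1 q.2 = gadget e r (insert a s) q.1 q.2 := by
  obtain ⟨i, j⟩ := q
  obtain ⟨i, rfl⟩ := e.surjective i
  obtain ⟨j, rfl⟩ := e.surjective j
  rcases i with (i | i) | i <;> rcases j with (j | j) | j <;> simp [gadget, blockGadget]
  intro h
  simp [← h] at hq

/-- Both factors come from rank-one matrices: the product of the off-diagonal blocks, of trace
`|s|`, and the last diagonal block, of trace `r`. -/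
theorem charpoly_gadget {N n p : ℕ} (e : (Fin n ⊕ Fin n) ⊕ Fin p ≃ Fin N) (r : ℕ) (hr : r ≤ p)
    (s : Finset (Fin n × Fin n)) :
    (toComplex (gadget e r s)).charpoly =
      (X ^ (2 * n) - C (s.card : ℂ) * X ^ (2 * (n - 1))) * (X ^ p - C (r : ℂ) * X ^ (p - 1)) := by
  have h1 : toComplex (gadget e r s) = reindex e e (fromBlocks
      (fromBlocks 0 (of fun i j => if (i, j) ∈ s then 1 else 0) (of fun _ _ => 1) 0) 0 0
      (vecMulVec (fun _ => 1) (fun j => if j.val < r then 1 else 0))) := by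
    ext i j
    obtain ⟨i, rfl⟩ := e.surjective i
    obtain ⟨j, rfl⟩ := e.surjective j
    rcases i with (i | i) | i <;> rcases j with (j | j) | j <;>
      simp [toComplex, gadget, blockGadget, vecMulVec]
  have h2 : (of fun i j => if (i, j) ∈ s then (1 : ℂ) else 0) * (of fun _ _ => 1) =
      vecMulVec (fun i : Fin n => ∑ j, if (i, j) ∈ s then (1 : ℂ) else 0)
        (fun _ : Fin n => 1) := by
    ext i j
    simp [mul_apply, vecMulVec]
  have h3 : (∑ i : Fin n, ∑ j : Fin n, if (i, j) ∈ s then (1 : ℂ) else 0) = s.card := by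
    rw [← Fintype.sum_prod_type' (f := fun i j => if (i, j) ∈ s then (1 : ℂ) else 0)]
    simp
  have h4 : (∑ j : Fin p, if j.val < r then (1 : ℂ) else 0) = r := by
    rw [Fin.sum_univ_eq_sum_range (fun j => if j < r then (1 : ℂ) else 0), ← Finset.sum_filter]
    have : (range p).filter (· < r) = range r := by
      ext j
      simp only [mem_filter, mem_range]
      omega
    simp [this]
  rw [h1, charpoly_reindex, charpoly_fromBlocks_zero₁₂, charpoly_fromBlocks_antidiagonal, h2,
    charpoly_vecMulVec, charpoly_vecMulVec]
  simp only [dotProduct, mul_one, one_mul, h3, h4, Polynomial.smul_eq_C_mul, Fintype.card_fin,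
    map_sub, map_mul, map_pow, Polynomial.expand_X, Polynomial.expand_C, ← pow_mul]

theorem roots_charpoly_gadget {N n p : ℕ} (e : (Fin n ⊕ Fin n) ⊕ Fin p ≃ Fin N) (r : ℕ)
    (hn : 0 < n) (hp : 0 < p) (hr : r ≤ p) (s : Finset (Fin n × Fin n)) :
    (toComplex (gadget e r s)).charpoly.roots =
      ((√s.card : ℝ) : ℂ) ::ₘ (r : ℂ) ::ₘ (-(√s.card : ℝ) : ℂ) ::ₘ
        Multiset.replicate (2 * (n - 1) + (p - 1)) 0 := by
  rw [← Polynomial.roots_multiset_prod_X_sub_C (_ ::ₘ _)]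
  congr 1
  rw [charpoly_gadget e r hr s]
  obtain ⟨n, rfl⟩ := Nat.exists_eq_succ_of_ne_zero hn.ne'
  obtain ⟨p, rfl⟩ := Nat.exists_eq_succ_of_ne_zero hp.ne'
  have hs : (C (s.card : ℂ)) = C ((√s.card : ℝ) : ℂ) * C ((√s.card : ℝ) : ℂ) := by
    rw [← map_mul, ← Complex.ofReal_mul, Real.mul_self_sqrt (by positivity), Complex.ofReal_natCast]
  simp only [Multiset.map_cons, Multiset.prod_cons, Multiset.map_replicate,
    Multiset.prod_replicate, hs, map_neg, map_zero, Nat.succ_eq_add_one, Nat.add_sub_cancel]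
  ring

theorem eigenvalueList_gadget {N n p : ℕ} (e : (Fin n ⊕ Fin n) ⊕ Fin p ≃ Fin N) (r : ℕ)
    (hn : 0 < n) (hp : 0 < p) (hr : r ≤ p) (s : Finset (Fin n × Fin n)) (hs : r ^ 2 ≤ s.card) :
    ∃ l, eigenvalueList (gadget e r s) = ((√s.card : ℝ) : ℂ) :: (r : ℂ) :: l := by
  have hrs : (r : ℝ) ≤ √s.card := Real.le_sqrt_of_sq_le (by exact_mod_cast hs)
  have h0 : (0 : ℝ) ≤ √s.card := Real.sqrt_nonneg _
  have hprec : ∀ x y : ℝ, y ≤ x → Precedes x y := fun x y h => by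
    rcases h.lt_or_eq with h | rfl
    · exact Or.inl (by simpa using h)
    · exact Or.inr ⟨rfl, le_rfl⟩
  have h1 : ∀ x : ℝ, 0 ≤ x → ∀ b ∈ (-(√s.card : ℝ) : ℂ) ::ₘ
      Multiset.replicate (2 * (n - 1) + (p - 1)) 0, Precedes x b := by
    intro x hx b hb
    rcases Multiset.mem_cons.mp hb with rfl | hb
    · exact_mod_cast hprec x (-√s.card) (by linarith)
    · rw [Multiset.eq_of_mem_replicate hb]
      exact_mod_cast hprec x 0 hx
  have h2 := h1 r (Nat.cast_nonneg r)
  -- The roots were listed with `√|s|` and `r` in front; it remains to check that each precedes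
  -- everything after it.
  rw [eigenvalueList, roots_charpoly_gadget e r hn hp hr s, Multiset.sort_cons, Multiset.sort_cons]
  · exact ⟨_, rfl⟩
  · exact_mod_cast h2
  · intro b hb
    rcases Multiset.mem_cons.mp hb with rfl | hb
    · exact_mod_cast hprec _ r hrs
    · exact h1 _ h0 b hb

theorem spectralGap_gadget {N n p : ℕ} (e : (Fin n ⊕ Fin n) ⊕ Fin p ≃ Fin N) (r : ℕ)
    (hn : 0 < n) (hp : 0 < p) (hr : r ≤ p) (s : Finset (Fin n × Fin n)) (hs : r ^ 2 ≤ s.card) :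
    0 < spectralGap (gadget e r s) 1 ↔ s.card ≠ r ^ 2 := by
  obtain ⟨l, hl⟩ := eigenvalueList_gadget e r hn hp hr s hs
  have : spectralGap (gadget e r s) 1 = ‖((√s.card : ℝ) : ℂ) - (r : ℂ)‖ := by
    simp [spectralGap, eigenvalue, hl]
  rw [this, norm_pos_iff, sub_ne_zero, not_iff_not, ← Complex.ofReal_natCast, Complex.ofReal_inj,
    Real.sqrt_eq_iff_eq_sq (by positivity) (by positivity)]
  exact_mod_cast Iff.rfl

end SpectralGapQuery

/-! ### Choice of parameters. -/

theorem mainTheorem3 (ε : ℝ) (hε : ε < 1 / 2) :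
    ∃ c : ℝ, 0 < c ∧ ∃ N₀ : ℕ, ∀ N : ℕ, N₀ ≤ N →
      ∀ 𝒜 : ℕ → SpectralGapQuery.QueryAlgorithm N,
        (∀ k : ℕ, 1 ≤ k → k + 1 ≤ N →
          (𝒜 k).Decides ε (fun A => 0 < SpectralGapQuery.spectralGap A k)) →
        ∃ k : ℕ, 1 ≤ k ∧ k + 1 ≤ N ∧ c * (N : ℝ) ^ 2 ≤ ((𝒜 k).numQueries : ℝ) := by
  have hδ : 0 < (1 - 2 * ε) ^ 2 := pow_pos (by linarith) 2
  refine ⟨(1 - 2 * ε) ^ 2 / 216, by positivity, 5, fun N hN 𝒜 h𝒜 =>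
    ⟨1, le_rfl, by omega, ?_⟩⟩
  -- The grid has side `n = 2r`, and `5r ≤ N` leaves room for the `r` nonzero columns of the last
  -- block.
  obtain ⟨r, hr, hr1, hr2⟩ : ∃ r, 0 < r ∧ 5 * r ≤ N ∧ N ≤ 9 * r :=
    ⟨N / 5, by omega, by omega, by omega⟩
  let e : (Fin (2 * r) ⊕ Fin (2 * r)) ⊕ Fin (N - 4 * r) ≃ Fin N :=
    Fintype.equivFinOfCardEq (by simp only [Fintype.card_sum, Fintype.card_fin]; omega)
  have hgap := SpectralGapQuery.spectralGap_gadget e r (by omega) (by omega) (by omega)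
  have hdec := h𝒜 1 le_rfl (by omega)
  have hpos : Function.Injective fun a : Fin (2 * r) × Fin (2 * r) =>
      (e (.inl (.inl a.1)), e (.inl (.inr a.2))) := by
    rintro ⟨i, j⟩ ⟨i', j'⟩ h
    simpa using h
  have hcard : Fintype.card (Fin (2 * r) × Fin (2 * r)) = 4 * r ^ 2 := by
    simp only [Fintype.card_prod, Fintype.card_fin]
    ring
  have hbound := (𝒜 1).layer_lower_bound (SpectralGapQuery.gadget e r) _ hpos
    (SpectralGapQuery.gadget_insert e r) (r ^ 2) (by omega) ε hε
    (fun s hs => by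
      have := (hdec (SpectralGapQuery.gadget e r s)).2 (by
        exact (hgap s hs.ge).not.mpr (not_not_intro hs))
      linarith)
    (fun s hs => (hdec (SpectralGapQuery.gadget e r s)).1 ((hgap s (by omega)).mpr (by omega)))
  rw [hcard] at hbound
  push_cast at hbound
  have hN2 : (N : ℝ) ^ 2 ≤ 81 * (r : ℝ) ^ 2 := by
    have : (N : ℝ) ≤ 9 * r := by exact_mod_cast hr2
    nlinarith [(Nat.cast_nonneg N : (0 : ℝ) ≤ N)]
  have hT : (0 : ℝ) ≤ (𝒜 1).numQueries := Nat.cast_nonneg _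
  -- Since `4r² + 1 ≤ 4(r² + 1)`, the factor `r² + 1` cancels, leaving `T ≥ 3r²(1-2ε)²/8`. With `N²
  -- ≤ 81r²` this yields the constant `216 = 81 · 8 / 3`.
  have h1 : ((r : ℝ) ^ 2 + 1) * (3 * (r : ℝ) ^ 2 * ((1 - 2 * ε) ^ 2 / 2)) ≤
      ((r : ℝ) ^ 2 + 1) * (4 * (𝒜 1).numQueries) := by linarith
  have h2 := le_of_mul_le_mul_left h1 (by positivity)
  have h3 := mul_le_mul_of_nonneg_left hN2 hδ.le
  linarith
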